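/- Let $n\ge 1$ and let $\mathcal A u=-\sum_{j,k=1}^n\partial_j(a_{jk}\partial_k u)+au$ on $\mathbb R^n$, where $a_{jk}=a_{kj}\in C^\infty(\mathbb R^n)$ are real-valued and bounded together with all their derivatives, $a\in C^\infty(\mathbb R^n)$ is real-valued and bounded, and $\sum_{j,k}a_{jk}(x)\xi_j\xi_k\ge C|\xi|^2$ for all $x,\xi\in\mathbb R^n$ with some constant $C>0$. Let $\Sigma\subset\mathbb R^n$ be a compact $C^\infty$-smooth hypersurface separating $\mathbb R^n$ into a bounded open set $\Omega_-$ and an unbounded open set $\Omega_+$, with $\Omega_-$ and $\Omega_+$ lying locally on the two different sides of $\Sigma$. For $u=u_+\oplus u_-\in H^2(\Omega_+)\oplus H^2(\Omega_-)\subset L_2(\mathbb R^n)$ let $\gamma^\pm u_\pm$ be the traces on $\Sigma$, let $\nu^\pm u_\pm=\sum_{j,k}a_{jk}\nu_{\pm,j}\gamma^\pm\partial_k u_\pm$ be the conormal derivatives, where $(\nu_{\pm,1},\dots,\nu_{\pm,n})$ is the exterior unit normal of $\Omega_\pm$, and put $$\varrho u=(\gamma^+u_+,\ \gamma^-u_-,\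 \nu^+u_+,\ \nu^-u_-)^\top .$$ Let $\alpha,\beta\in C^\infty(\Sigma)$ be real-valued, $\beta$ without zeros, and let $B_*$ be one of the matrices $$B_0=\begin{pmatrix}1&-1&0&0\\0&0&1&1\end{pmatrix},\quad B_\gamma=\begin{pmatrix}1&0&0&0\\0&1&0&0\end{pmatrix},\quad B_\nu=\begin{pmatrix}0&0&1&0\\0&0&0&1\end{pmatrix},$$ $$B_{\delta,\alpha}=\begin{pmatrix}1&-1&0&0\\-\alpha&0&1&1\end{pmatrix},\quad B_{\delta',\beta}=\begin{pmatrix}1&-1&-\beta&0\\0&0&1&1\end{pmatrix}.$$ Let $A_*$ be the operator $u\mapsto\mathcal A u_+\oplus\mathcal A u_-$ in $L_2(\mathbb R^n)$ with domain $\{u\in H^2(\Omega_+)\oplus H^2(\Omega_-): B_*\varrho u=0\}$, and let $A_\gamma$, $A_\nu$ be the operators obtained in this way from $B_\gamma$, $B_\nu$. Assume that $0$ belongs to the resolvent sets of $A_*$, $A_\gamma$ and $A_\nu$ (which can be achieved by adding a large constant to $a$). Let $R_*$, $R_\gamma$, $R_\nu$ be the ranges of $B_*\varrho$, $B_\gamma\varrho$,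 $B_\nu\varrho$ on $H^2(\Omega_+)\oplus H^2(\Omega_-)$ (by the trace theorem, $R_\gamma=H^{3/2}(\Sigma)^2$, $R_\nu=H^{1/2}(\Sigma)^2$, and $R_*=H^{3/2}(\Sigma)\times H^{1/2}(\Sigma)$ in the other three cases). Let $K_\gamma$ be the solution operator $\varphi\mapsto u$ of the problem $$u\in H^2(\Omega_+)\oplus H^2(\Omega_-),\qquad \mathcal A u_+\oplus\mathcal A u_-=0,\qquad B_\gamma\varrho u=\varphi,$$ let $K_\nu$ be the solution operator of the same problem with $B_\nu$ in place of $B_\gamma$, and put $\Phi_*=B_*\varrho K_\gamma$ and $\Psi_*=B_*\varrho K_\nu$. Then: 1. $K_\gamma$ is defined on all of $R_\gamma$, $\Phi_*$ maps $R_\gamma$ bijectively onto $R_*$, and $$A_*^{-1}-A_\gamma^{-1}=-K_\gamma\Phi_*^{-1}B_*\varrho A_\gamma^{-1}\quad\text{on } L_2(\mathbb R^n).$$ 2. $K_\nu$ is defined on all of $R_\nu$, $\Psi_*$ maps $R_\nu$ bijectively onto $R_*$, and $$A_*^{-1}-A_\nu^{-1}=-K_\nu\Psi_*^{-1}B_*\varrho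 A_\nu^{-1}\quad\text{on } L_2(\mathbb R^n).$$ -/

import Mathlib

open MeasureTheory Set Filter
open scoped ContDiff ENNReal Topology

noncomputable section

namespace Krein

/-! ### Geometry, coefficients, function spaces -/

/-- Euclidean space `ℝⁿ`. -/
abbrev E (n : ℕ) := EuclideanSpace ℝ (Fin n)

/-- The complex Hilbert space `L₂(ℝⁿ)`. -/
abbrev L2 (n : ℕ) := Lp ℂ 2 (volume : Measure (E n))

/-- A compact `C^∞` hypersurface `surface` separating `ℝⁿ` into a bounded open set `inner` (`Ω₋`)
and an unbounded open set `outer` (`Ω₊`). Locally the three sets are `{r = 0}`, `{r < 0}`,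
`{r > 0}` for a smooth `r` with nonvanishing gradient on the surface, and on the surface `normal`
is the unit normal pointing out of `Ω₋` (it is thereby determined on the surface). -/
structure Interface (n : ℕ) where
  surface : Set (E n)
  outer : Set (E n)
  inner : Set (E n)
  normal : E n → E n
  isOpen_outer : IsOpen outer
  isOpen_inner : IsOpen inner
  isBounded_inner : Bornology.IsBounded inner
  not_isBounded_outer : ¬ Bornology.IsBounded outer
  isCompact_surface : IsCompact surface
  disjoint_outer_inner : Disjoint outer inner
  surface_eq : surface = (outer ∪ inner)ᶜ
  exists_local : ∀ x ∈ surface, ∃ U : Set (E n), IsOpen U ∧ x ∈ U ∧ ∃ r : E n → ℝ,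
    ContDiffOn ℝ ∞ r U ∧
    (∀ y ∈ U, (y ∈ surface ↔ r y = 0) ∧ (y ∈ inner ↔ r y < 0) ∧ (y ∈ outer ↔ 0 < r y)) ∧
    (∀ y ∈ U ∩ surface, gradient r y ≠ 0 ∧ normal y = ‖gradient r y‖⁻¹ • gradient r y)

/-- Coefficients of the formally symmetric, uniformly strongly elliptic expression
`𝒜 u = - ∑ⱼₖ ∂ⱼ (aⱼₖ ∂ₖ u) + a u`. -/
structure Coeffs (n : ℕ) where
  a : Fin n → Fin n → E n → ℝ
  a0 : E n → ℝ
  smooth : ∀ j k, ContDiff ℝ ∞ (a j k)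
  bounded : ∀ j k (m : ℕ), ∃ C : ℝ, ∀ x, ‖iteratedFDeriv ℝ m (a j k) x‖ ≤ C
  symm : ∀ j k x, a j k x = a k j x
  elliptic : ∃ C : ℝ, 0 < C ∧ ∀ (x : E n) (ξ : E n),
    C * ‖ξ‖ ^ 2 ≤ ∑ j, ∑ k, a j k x * ξ j * ξ k
  smooth_a0 : ContDiff ℝ ∞ a0
  bounded_a0 : ∃ C : ℝ, ∀ x, |a0 x| ≤ C

variable {n : ℕ}

/-- The `j`-th partial derivative of a smooth function. -/
def partialDeriv {F : Type*} [NormedAddCommGroup F] [NormedSpace ℝ F] (j : Fin n) (φ : E n → F)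
    (x : E n) : F :=
  fderiv ℝ φ x (EuclideanSpace.single j 1)

/-- Real test functions on `ℝⁿ`. -/
def IsTest (φ : E n → ℝ) : Prop := ContDiff ℝ ∞ φ ∧ HasCompactSupport φ

/-- `v` is the weak derivative `∂ⱼ u` on the open set `Ω`. -/
def WeakPartial (Ω : Set (E n)) (j : Fin n) (u v : E n → ℂ) : Prop :=
  ∀ φ : E n → ℝ, IsTest φ → tsupport φ ⊆ Ω →
    ∫ x in Ω, partialDeriv j φ x • u x = - ∫ x in Ω, φ x • v x

/-- `v` is an `L₂(Ω)` function which is the weak derivative `∂ⱼ u` on `Ω`. -/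
def L2Partial (Ω : Set (E n)) (j : Fin n) (u v : E n → ℂ) : Prop :=
  MemLp v 2 (volume.restrict Ω) ∧ WeakPartial Ω j u v

/-- `u ∈ H²(Ω)`: `u` and its weak derivatives of order one and two are in `L₂(Ω)`. -/
def MemH2 (Ω : Set (E n)) (u : E n → ℂ) : Prop :=
  MemLp u 2 (volume.restrict Ω) ∧
    ∃ (w : Fin n → E n → ℂ) (h : Fin n → Fin n → E n → ℂ),
      (∀ j, L2Partial Ω j u (w j)) ∧ ∀ i j, L2Partial Ω i (w j) (h i j)

/-- `𝒜 u = f` in `L₂(Ω)`: with `w k = ∂ₖ u` and `q j = ∂ⱼ (∑ₖ aⱼₖ ∂ₖ u)` in the weak sense,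
`f = - ∑ⱼ q j + a u`. -/
def EllipticEq (c : Coeffs n) (Ω : Set (E n)) (u f : E n → ℂ) : Prop :=
  ∃ w q : Fin n → E n → ℂ,
    (∀ k, L2Partial Ω k u (w k)) ∧
    (∀ j, L2Partial Ω j (fun x => ∑ k, c.a j k x • w k x) (q j)) ∧
    ∀ᵐ x ∂(volume.restrict Ω), f x = - ∑ j, q j x + c.a0 x • u x

namespace Interface

/-- The surface measure of the hypersurface. -/
def σ (S : Interface n) : Measure (E n) := (μHE[n - 1]).restrict S.surface

/-- The complex Hilbert space `L₂(Σ)`. -/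
abbrev L2Surf (S : Interface n) := Lp ℂ 2 S.σ

/-- `g ∈ L₂(Σ)` is the trace on `Σ` of `u ∈ H¹(Ω)`, where `Ω` is one of the two sides of `Σ`:
the trace map `H¹(Ω) → L₂(Σ)` is the extension by continuity of the restriction `φ ↦ φ|_Σ`, so
there are `φₘ ∈ C_c^∞(ℝⁿ)` with `φₘ → u` in `H¹(Ω)` and `φₘ → g` in `L₂(Σ)`. -/
def HasTrace (S : Interface n) (Ω : Set (E n)) (u : E n → ℂ) (g : S.L2Surf) : Prop :=
  MemLp u 2 (volume.restrict Ω) ∧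
  ∃ w : Fin n → E n → ℂ, (∀ j, L2Partial Ω j u (w j)) ∧
  ∃ φ : ℕ → E n → ℂ, (∀ m, ContDiff ℝ ∞ (φ m) ∧ HasCompactSupport (φ m)) ∧
    Tendsto (fun m => eLpNorm (φ m - u) 2 (volume.restrict Ω)) atTop (𝓝 0) ∧
    (∀ j, Tendsto (fun m => eLpNorm (partialDeriv j (φ m) - w j) 2 (volume.restrict Ω))
      atTop (𝓝 0)) ∧
    Tendsto (fun m => eLpNorm (φ m - (g : E n → ℂ)) 2 S.σ) atTop (𝓝 0)

/-- `g ∈ L₂(Σ)` is the conormal derivative `∑ⱼₖ aⱼₖ Nⱼ γ(∂ₖ u)` of `u ∈ H²(Ω)`, where `N` is the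
exterior unit normal of `Ω`. -/
def HasConormal (S : Interface n) (c : Coeffs n) (Ω : Set (E n)) (N : E n → E n)
    (u : E n → ℂ) (g : S.L2Surf) : Prop :=
  ∃ (w : Fin n → E n → ℂ) (t : Fin n → S.L2Surf),
    (∀ k, L2Partial Ω k u (w k)) ∧ (∀ k, S.HasTrace Ω (w k) (t k)) ∧
    ∀ᵐ x ∂S.σ, g x = ∑ j, ∑ k, (c.a j k x * N x j) • t k x

/-- The exterior unit normal of `Ω₊`. -/
def outerNormal (S : Interface n) : E n → E n := fun x => - S.normal x

/-- `u ∈ H²(Ω₊) ⊕ H²(Ω₋)`. -/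
def MemH2Sum (S : Interface n) (u : E n → ℂ) : Prop := MemH2 S.outer u ∧ MemH2 S.inner u

end Interface

/-! ### Linearity of the notions above -/

lemma IsTest.memLp {φ : E n → ℝ} (h : IsTest φ) (μ : Measure (E n))
    [IsFiniteMeasureOnCompacts μ] : MemLp φ 2 μ :=
  h.1.continuous.memLp_of_hasCompactSupport h.2

lemma IsTest.partialDeriv_memLp {φ : E n → ℝ} (h : IsTest φ) (j : Fin n) (μ : Measure (E n))
    [IsFiniteMeasureOnCompacts μ] : MemLp (partialDeriv j φ) 2 μ := by
  have h1 : Continuous (fderiv ℝ φ) := h.1.continuous_fderiv (by simp)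
  have h2 : HasCompactSupport (fun x => fderiv ℝ φ x (EuclideanSpace.single j 1)) :=
    h.2.fderiv_apply ℝ _
  exact (h1.clm_apply continuous_const).memLp_of_hasCompactSupport h2

lemma integrable_smul {μ : Measure (E n)} {φ : E n → ℝ} {u : E n → ℂ}
    (hφ : MemLp φ 2 μ) (hu : MemLp u 2 μ) : Integrable (fun x => φ x • u x) μ :=
  memLp_one_iff_integrable.1 (hu.smul hφ)

lemma L2Partial.add {Ω : Set (E n)} {j : Fin n} {u u' v v' : E n → ℂ}
    (hu : MemLp u 2 (volume.restrict Ω)) (hu' : MemLp u' 2 (volume.restrict Ω))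
    (h : L2Partial Ω j u v) (h' : L2Partial Ω j u' v') : L2Partial Ω j (u + u') (v + v') := by
  refine ⟨h.1.add h'.1, fun φ hφ hs => ?_⟩
  have e := h.2 φ hφ hs
  have e' := h'.2 φ hφ hs
  simp only [Pi.add_apply, smul_add]
  rw [integral_add (integrable_smul (hφ.partialDeriv_memLp j _) hu)
    (integrable_smul (hφ.partialDeriv_memLp j _) hu'),
    integral_add (integrable_smul (hφ.memLp _) h.1) (integrable_smul (hφ.memLp _) h'.1), e, e']
  ring

lemma L2Partial.smul {Ω : Set (E n)} {j : Fin n} {u v : E n → ℂ} (z : ℂ)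
    (h : L2Partial Ω j u v) : L2Partial Ω j (z • u) (z • v) := by
  refine ⟨h.1.const_smul z, fun φ hφ hs => ?_⟩
  have e := h.2 φ hφ hs
  simp only [Pi.smul_apply, smul_comm _ z]
  rw [integral_smul, integral_smul, e, smul_neg]

lemma L2Partial.zero {Ω : Set (E n)} {j : Fin n} : L2Partial Ω j 0 0 :=
  ⟨MemLp.zero, fun φ _ _ => by simp⟩

lemma L2Partial.congr {Ω : Set (E n)} {j : Fin n} {u u' v : E n → ℂ}
    (hu : u =ᵐ[volume.restrict Ω] u') (h : L2Partial Ω j u v) : L2Partial Ω j u' v := by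
  refine ⟨h.1, fun φ hφ hs => ?_⟩
  rw [← h.2 φ hφ hs]
  refine integral_congr_ae ?_
  filter_upwards [hu] with x hx
  simp only [hx]

lemma MemH2.add {Ω : Set (E n)} {u u' : E n → ℂ} (h : MemH2 Ω u) (h' : MemH2 Ω u') :
    MemH2 Ω (u + u') := by
  obtain ⟨m, w, d, hw, hd⟩ := h
  obtain ⟨m', w', d', hw', hd'⟩ := h'
  exact ⟨m.add m', w + w', d + d', fun j => (hw j).add m m' (hw' j),
    fun i j => (hd i j).add (hw j).1 (hw' j).1 (hd' i j)⟩

lemma MemH2.smul {Ω : Set (E n)} {u : E n → ℂ} (z : ℂ) (h : MemH2 Ω u) : MemH2 Ω (z • u) := by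
  obtain ⟨m, w, d, hw, hd⟩ := h
  exact ⟨m.const_smul z, z • w, z • d, fun j => (hw j).smul z, fun i j => (hd i j).smul z⟩

lemma MemH2.zero {Ω : Set (E n)} : MemH2 Ω (0 : E n → ℂ) :=
  ⟨MemLp.zero, 0, 0, fun _ => L2Partial.zero, fun _ _ => L2Partial.zero⟩

lemma MemH2.congr {Ω : Set (E n)} {u u' : E n → ℂ} (hu : u =ᵐ[volume.restrict Ω] u')
    (h : MemH2 Ω u) : MemH2 Ω u' := by
  obtain ⟨m, w, d, hw, hd⟩ := h
  exact ⟨m.ae_eq hu, w, d, fun j => (hw j).congr hu, hd⟩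

lemma Coeffs.memLp_flux (c : Coeffs n) {Ω : Set (E n)} {w : Fin n → E n → ℂ}
    (hw : ∀ k, MemLp (w k) 2 (volume.restrict Ω)) (j : Fin n) :
    MemLp (fun x => ∑ k, c.a j k x • w k x) 2 (volume.restrict Ω) := by
  refine memLp_finsetSum _ fun k _ => ?_
  obtain ⟨C, hC⟩ := c.bounded j k 0
  have hb : MemLp (c.a j k) ∞ (volume.restrict Ω) :=
    memLp_top_of_bound (c.smooth j k).continuous.aestronglyMeasurable C
      (ae_of_all _ fun x => by simpa using hC x)
  exact (hw k).smul hb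

lemma EllipticEq.add {c : Coeffs n} {Ω : Set (E n)} {u u' f f' : E n → ℂ}
    (hu : MemLp u 2 (volume.restrict Ω)) (hu' : MemLp u' 2 (volume.restrict Ω))
    (h : EllipticEq c Ω u f) (h' : EllipticEq c Ω u' f') :
    EllipticEq c Ω (u + u') (f + f') := by
  obtain ⟨w, q, hw, hq, e⟩ := h
  obtain ⟨w', q', hw', hq', e'⟩ := h'
  refine ⟨w + w', q + q', fun k => (hw k).add hu hu' (hw' k), fun j => ?_, ?_⟩
  · have := (hq j).add (c.memLp_flux (fun k => (hw k).1) j)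
      (c.memLp_flux (fun k => (hw' k).1) j) (hq' j)
    have e1 : (fun x => ∑ k, c.a j k x • (w + w') k x) =
        (fun x => ∑ k, c.a j k x • w k x) + fun x => ∑ k, c.a j k x • w' k x := by
      funext x
      simp [Finset.sum_add_distrib]
    rw [e1]
    exact this
  · filter_upwards [e, e'] with x hx hx'
    simp only [Pi.add_apply, hx, hx', Finset.sum_add_distrib, smul_add]
    ring

lemma EllipticEq.smul {c : Coeffs n} {Ω : Set (E n)} {u f : E n → ℂ} (z : ℂ)
    (h : EllipticEq c Ω u f) : EllipticEq c Ω (z • u) (z • f) := by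
  obtain ⟨w, q, hw, hq, e⟩ := h
  refine ⟨z • w, z • q, fun k => (hw k).smul z, fun j => ?_, ?_⟩
  · have e1 : (fun x => ∑ k, c.a j k x • (z • w) k x) =
        z • fun x => ∑ k, c.a j k x • w k x := by
      funext x
      simp only [Pi.smul_apply, smul_comm _ z, Finset.smul_sum]
    rw [e1]
    exact (hq j).smul z
  · filter_upwards [e] with x hx
    simp only [Pi.smul_apply, hx, smul_add, smul_neg, Finset.smul_sum, smul_comm _ z]

lemma EllipticEq.zero {c : Coeffs n} {Ω : Set (E n)} : EllipticEq c Ω 0 0 :=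
  ⟨0, 0, fun _ => L2Partial.zero, fun j => by
    have e1 : (fun x => ∑ k, c.a j k x • (0 : Fin n → E n → ℂ) k x) = 0 := by
      funext x
      simp
    rw [e1]
    exact L2Partial.zero, by simp⟩

lemma EllipticEq.congr {c : Coeffs n} {Ω : Set (E n)} {u u' f f' : E n → ℂ}
    (hu : u =ᵐ[volume.restrict Ω] u') (hf : f =ᵐ[volume.restrict Ω] f')
    (h : EllipticEq c Ω u f) : EllipticEq c Ω u' f' := by
  obtain ⟨w, q, hw, hq, e⟩ := h
  refine ⟨w, q, fun k => (hw k).congr hu, hq, ?_⟩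
  filter_upwards [e, hu, hf] with x hx h1 h2
  rw [← h1, ← h2, hx]

namespace Interface

variable {S : Interface n} {c : Coeffs n} {Ω : Set (E n)} {N : E n → E n}

lemma tendsto_eLpNorm_add {μ : Measure (E n)} {f g : ℕ → E n → ℂ}
    (hfm : ∀ m, AEStronglyMeasurable (f m) μ) (hgm : ∀ m, AEStronglyMeasurable (g m) μ)
    (hf : Tendsto (fun m => eLpNorm (f m) 2 μ) atTop (𝓝 0))
    (hg : Tendsto (fun m => eLpNorm (g m) 2 μ) atTop (𝓝 0)) :
    Tendsto (fun m => eLpNorm (f m + g m) 2 μ) atTop (𝓝 0) :=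
  tendsto_of_tendsto_of_tendsto_of_le_of_le tendsto_const_nhds
    (by simpa using hf.add hg) (fun _ => zero_le)
    fun m => eLpNorm_add_le (hfm m) (hgm m) (by norm_num)

lemma tendsto_eLpNorm_smul {μ : Measure (E n)} {f : ℕ → E n → ℂ} (z : ℂ)
    (hf : Tendsto (fun m => eLpNorm (f m) 2 μ) atTop (𝓝 0)) :
    Tendsto (fun m => eLpNorm (z • f m) 2 μ) atTop (𝓝 0) := by
  simp only [eLpNorm_const_smul]
  simpa using ENNReal.Tendsto.const_mul hf (Or.inr enorm_ne_top)

lemma continuous_partialDeriv {φ : E n → ℂ} (h : ContDiff ℝ ∞ φ) (j : Fin n) :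
    Continuous (partialDeriv j φ) :=
  (h.continuous_fderiv (by simp)).clm_apply continuous_const

lemma partialDeriv_add {φ ψ : E n → ℂ} (h : ContDiff ℝ ∞ φ) (h' : ContDiff ℝ ∞ ψ) (j : Fin n) :
    partialDeriv j (φ + ψ) = partialDeriv j φ + partialDeriv j ψ := by
  funext x
  simp [partialDeriv, fderiv_add (h.differentiable (by simp) x) (h'.differentiable (by simp) x)]

lemma partialDeriv_smul {φ : E n → ℂ} (h : ContDiff ℝ ∞ φ) (z : ℂ) (j : Fin n) :
    partialDeriv j (z • φ) = z • partialDeriv j φ := by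
  funext x
  simp [partialDeriv, fderiv_const_smul (h.differentiable (by simp) x) z]

lemma HasTrace.add {u u' : E n → ℂ} {g g' : S.L2Surf} (h : S.HasTrace Ω u g)
    (h' : S.HasTrace Ω u' g') : S.HasTrace Ω (u + u') (g + g') := by
  obtain ⟨m, w, hw, φ, hφ, e1, e2, e3⟩ := h
  obtain ⟨m', w', hw', φ', hφ', e1', e2', e3'⟩ := h'
  have c1 : ∀ k (μ : Measure (E n)), AEStronglyMeasurable (φ k) μ :=
    fun k μ => (hφ k).1.continuous.aestronglyMeasurable
  have c2 : ∀ k (μ : Measure (E n)), AEStronglyMeasurable (φ' k) μ :=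
    fun k μ => (hφ' k).1.continuous.aestronglyMeasurable
  refine ⟨m.add m', w + w', fun j => (hw j).add m m' (hw' j), φ + φ', fun k =>
    ⟨(hφ k).1.add (hφ' k).1, (hφ k).2.add (hφ' k).2⟩, ?_, fun j => ?_, ?_⟩
  · have := tendsto_eLpNorm_add (fun k => (c1 k _).sub m.1) (fun k => (c2 k _).sub m'.1) e1 e1'
    simpa only [Pi.add_apply, add_sub_add_comm] using this
  · have := tendsto_eLpNorm_add
      (fun k => (continuous_partialDeriv (hφ k).1 j).aestronglyMeasurable.sub (hw j).1.1)
      (fun k => (continuous_partialDeriv (hφ' k).1 j).aestronglyMeasurable.sub (hw' j).1.1)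
      (e2 j) (e2' j)
    simpa only [Pi.add_apply, add_sub_add_comm, partialDeriv_add (hφ _).1 (hφ' _).1] using this
  · have := tendsto_eLpNorm_add (fun k => (c1 k _).sub (Lp.aestronglyMeasurable g))
      (fun k => (c2 k _).sub (Lp.aestronglyMeasurable g')) e3 e3'
    refine this.congr fun k => eLpNorm_congr_ae ?_
    filter_upwards [Lp.coeFn_add g g'] with x hx
    simp only [Pi.add_apply, Pi.sub_apply, hx]
    ring

lemma HasTrace.smul {u : E n → ℂ} {g : S.L2Surf} (z : ℂ) (h : S.HasTrace Ω u g) :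
    S.HasTrace Ω (z • u) (z • g) := by
  obtain ⟨m, w, hw, φ, hφ, e1, e2, e3⟩ := h
  refine ⟨m.const_smul z, z • w, fun j => (hw j).smul z, z • φ, fun k =>
    ⟨(hφ k).1.const_smul z, (hφ k).2.smul_left (f := fun _ => z)⟩, ?_, fun j => ?_, ?_⟩
  · simpa only [Pi.smul_apply, smul_sub] using tendsto_eLpNorm_smul z e1
  · simpa only [Pi.smul_apply, smul_sub, partialDeriv_smul (hφ _).1] using
      tendsto_eLpNorm_smul z (e2 j)
  · refine (tendsto_eLpNorm_smul z e3).congr fun k => eLpNorm_congr_ae ?_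
    filter_upwards [Lp.coeFn_smul z g] with x hx
    simp only [Pi.smul_apply, Pi.sub_apply, hx, smul_sub]

lemma HasTrace.zero : S.HasTrace Ω 0 0 := by
  refine ⟨MemLp.zero, 0, fun _ => L2Partial.zero, 0, fun _ =>
    ⟨contDiff_const, HasCompactSupport.zero⟩, ?_, fun j => ?_, ?_⟩
  · simp
  · have : partialDeriv j (0 : E n → ℂ) = 0 := by
      funext x
      simp [partialDeriv]
    simp [this]
  · have : (0 : E n → ℂ) - ((0 : S.L2Surf) : E n → ℂ) =ᵐ[S.σ] 0 := by
      filter_upwards [Lp.coeFn_zero ℂ 2 S.σ] with x hx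
      simp only [Pi.sub_apply, hx, Pi.zero_apply, sub_zero]
    exact tendsto_const_nhds.congr fun _ => ((eLpNorm_congr_ae this).trans eLpNorm_zero).symm

lemma HasTrace.congr {u u' : E n → ℂ} {g : S.L2Surf} (hu : u =ᵐ[volume.restrict Ω] u')
    (h : S.HasTrace Ω u g) : S.HasTrace Ω u' g := by
  obtain ⟨m, w, hw, φ, hφ, e1, e2, e3⟩ := h
  refine ⟨m.ae_eq hu, w, fun j => (hw j).congr hu, φ, hφ, e1.congr fun k =>
    eLpNorm_congr_ae ?_, e2, e3⟩
  filter_upwards [hu] with x hx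
  simp only [Pi.sub_apply, hx]

lemma HasConormal.add {u u' : E n → ℂ} {g g' : S.L2Surf} (hu : MemLp u 2 (volume.restrict Ω))
    (hu' : MemLp u' 2 (volume.restrict Ω)) (h : S.HasConormal c Ω N u g)
    (h' : S.HasConormal c Ω N u' g') : S.HasConormal c Ω N (u + u') (g + g') := by
  obtain ⟨w, t, hw, ht, e⟩ := h
  obtain ⟨w', t', hw', ht', e'⟩ := h'
  refine ⟨w + w', t + t', fun k => (hw k).add hu hu' (hw' k), fun k => (ht k).add (ht' k), ?_⟩
  have : ∀ᵐ x ∂S.σ, ∀ k, (t + t') k x = t k x + t' k x :=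
    ae_all_iff.2 fun k => Lp.coeFn_add (t k) (t' k)
  filter_upwards [e, e', this, Lp.coeFn_add g g'] with x hx hx' hk hg
  rw [hg, Pi.add_apply, hx, hx']
  simp only [hk, smul_add, Finset.sum_add_distrib]

lemma HasConormal.smul {u : E n → ℂ} {g : S.L2Surf} (z : ℂ) (h : S.HasConormal c Ω N u g) :
    S.HasConormal c Ω N (z • u) (z • g) := by
  obtain ⟨w, t, hw, ht, e⟩ := h
  refine ⟨z • w, z • t, fun k => (hw k).smul z, fun k => (ht k).smul z, ?_⟩
  have : ∀ᵐ x ∂S.σ, ∀ k, (z • t) k x = z • t k x :=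
    ae_all_iff.2 fun k => Lp.coeFn_smul z (t k)
  filter_upwards [e, this, Lp.coeFn_smul z g] with x hx hk hg
  rw [hg, Pi.smul_apply, hx]
  simp only [hk, smul_comm _ z, Finset.smul_sum]

lemma HasConormal.zero : S.HasConormal c Ω N 0 0 := by
  refine ⟨0, 0, fun _ => L2Partial.zero, fun k => HasTrace.zero, ?_⟩
  have : ∀ᵐ x ∂S.σ, ∀ k, (0 : Fin n → S.L2Surf) k x = 0 :=
    ae_all_iff.2 fun _ => Lp.coeFn_zero ℂ 2 S.σ
  filter_upwards [this, Lp.coeFn_zero ℂ 2 S.σ] with x hk hg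
  rw [hg]
  refine (Finset.sum_eq_zero fun j _ => Finset.sum_eq_zero fun k _ => ?_).symm
  rw [hk k, smul_zero]

lemma HasConormal.congr {u u' : E n → ℂ} {g : S.L2Surf} (hu : u =ᵐ[volume.restrict Ω] u')
    (h : S.HasConormal c Ω N u g) : S.HasConormal c Ω N u' g := by
  obtain ⟨w, t, hw, ht, e⟩ := h
  exact ⟨w, t, fun k => (hw k).congr hu, ht, e⟩

end Interface

lemma L2.memLp_restrict (u : L2 n) (Ω : Set (E n)) : MemLp u 2 (volume.restrict Ω) :=
  (Lp.memLp u).restrict Ω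

/-! ### The operators -/

variable (S : Interface n) (c : Coeffs n)

/-- The graph of `u ↦ 𝒜₊ u₊ ⊕ 𝒜₋ u₋` on `H²(Ω₊) ⊕ H²(Ω₋)`. -/
def graphA : Submodule ℂ (L2 n × L2 n) where
  carrier := {p | S.MemH2Sum p.1 ∧ EllipticEq c S.outer p.1 p.2 ∧ EllipticEq c S.inner p.1 p.2}
  zero_mem' := by
    have h0 : ∀ Ω : Set (E n), (0 : E n → ℂ) =ᵐ[volume.restrict Ω] ((0 : L2 n) : E n → ℂ) :=
      fun Ω => Filter.EventuallyEq.symm (ae_restrict_of_ae (Lp.coeFn_zero ℂ 2 volume))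
    exact ⟨⟨MemH2.zero.congr (h0 _), MemH2.zero.congr (h0 _)⟩,
      EllipticEq.zero.congr (h0 _) (h0 _), EllipticEq.zero.congr (h0 _) (h0 _)⟩
  add_mem' := by
    rintro ⟨u, f⟩ ⟨v, g⟩ ⟨⟨a1, a2⟩, a3, a4⟩ ⟨⟨b1, b2⟩, b3, b4⟩
    have h : ∀ (u v : L2 n) (Ω : Set (E n)),
        ((u : E n → ℂ) + (v : E n → ℂ)) =ᵐ[volume.restrict Ω] ((u + v : L2 n) : E n → ℂ) :=
      fun u v Ω => Filter.EventuallyEq.symm (ae_restrict_of_ae (Lp.coeFn_add u v))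
    exact ⟨⟨(a1.add b1).congr (h _ _ _), (a2.add b2).congr (h _ _ _)⟩,
      (a3.add (L2.memLp_restrict u _) (L2.memLp_restrict v _) b3).congr (h _ _ _) (h _ _ _),
      (a4.add (L2.memLp_restrict u _) (L2.memLp_restrict v _) b4).congr (h _ _ _) (h _ _ _)⟩
  smul_mem' := by
    rintro z ⟨u, f⟩ ⟨⟨a1, a2⟩, a3, a4⟩
    have h : ∀ (u : L2 n) (Ω : Set (E n)),
        (z • (u : E n → ℂ)) =ᵐ[volume.restrict Ω] ((z • u : L2 n) : E n → ℂ) :=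
      fun u Ω => Filter.EventuallyEq.symm (ae_restrict_of_ae (Lp.coeFn_smul z u))
    exact ⟨⟨(a1.smul z).congr (h _ _), (a2.smul z).congr (h _ _)⟩,
      (a3.smul z).congr (h _ _) (h _ _), (a4.smul z).congr (h _ _) (h _ _)⟩

/-- The operator `u ↦ 𝒜₊ u₊ ⊕ 𝒜₋ u₋` in `L₂(ℝⁿ)` with domain `H²(Ω₊) ⊕ H²(Ω₋)`. -/
def opA : L2 n →ₗ.[ℂ] L2 n := (graphA S c).toLinearPMap

/-- The graph of the trace map `ϱ`. -/
def graphRho : Submodule ℂ (L2 n × (Fin 4 → S.L2Surf)) where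
  carrier := {p | S.MemH2Sum p.1 ∧
    S.HasTrace S.outer p.1 (p.2 0) ∧
    S.HasTrace S.inner p.1 (p.2 1) ∧
    S.HasConormal c S.outer S.outerNormal p.1 (p.2 2) ∧
    S.HasConormal c S.inner S.normal p.1 (p.2 3)}
  zero_mem' := by
    have h0 : ∀ Ω : Set (E n), (0 : E n → ℂ) =ᵐ[volume.restrict Ω] ((0 : L2 n) : E n → ℂ) :=
      fun Ω => Filter.EventuallyEq.symm (ae_restrict_of_ae (Lp.coeFn_zero ℂ 2 volume))
    exact ⟨⟨MemH2.zero.congr (h0 _), MemH2.zero.congr (h0 _)⟩,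
      Interface.HasTrace.zero.congr (h0 _), Interface.HasTrace.zero.congr (h0 _),
      Interface.HasConormal.zero.congr (h0 _), Interface.HasConormal.zero.congr (h0 _)⟩
  add_mem' := by
    rintro ⟨u, f⟩ ⟨v, g⟩ ⟨⟨a1, a2⟩, a3, a4, a5, a6⟩ ⟨⟨b1, b2⟩, b3, b4, b5, b6⟩
    have h : ∀ (Ω : Set (E n)),
        ((u : E n → ℂ) + (v : E n → ℂ)) =ᵐ[volume.restrict Ω] ((u + v : L2 n) : E n → ℂ) :=
      fun Ω => Filter.EventuallyEq.symm (ae_restrict_of_ae (Lp.coeFn_add u v))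
    have hu := L2.memLp_restrict u
    have hv := L2.memLp_restrict v
    exact ⟨⟨(a1.add b1).congr (h _), (a2.add b2).congr (h _)⟩,
      (a3.add b3).congr (h _), (a4.add b4).congr (h _),
      (a5.add (hu _) (hv _) b5).congr (h _), (a6.add (hu _) (hv _) b6).congr (h _)⟩
  smul_mem' := by
    rintro z ⟨u, f⟩ ⟨⟨a1, a2⟩, a3, a4, a5, a6⟩
    have h : ∀ (Ω : Set (E n)),
        (z • (u : E n → ℂ)) =ᵐ[volume.restrict Ω] ((z • u : L2 n) : E n → ℂ) :=
      fun Ω => Filter.EventuallyEq.symm (ae_restrict_of_ae (Lp.coeFn_smul z u))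
    exact ⟨⟨(a1.smul z).congr (h _), (a2.smul z).congr (h _)⟩,
      (a3.smul z).congr (h _), (a4.smul z).congr (h _),
      (a5.smul z).congr (h _), (a6.smul z).congr (h _)⟩

/-- The trace map `ϱ (u₊ ⊕ u₋) = (γ⁺u₊, γ⁻u₋, ν⁺u₊, ν⁻u₋)` on `H²(Ω₊) ⊕ H²(Ω₋)`. -/
def rho : L2 n →ₗ.[ℂ] (Fin 4 → S.L2Surf) := (graphRho S c).toLinearPMap

/-! ### Boundary-condition matrices -/

/-- Real-valued `C^∞` functions on the hypersurface (only the values on the hypersurface matter). -/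
structure SmoothFn where
  toFun : E n → ℝ
  smooth : ∀ x ∈ S.surface, ∃ U : Set (E n), IsOpen U ∧ x ∈ U ∧ ∃ f : E n → ℝ,
    ContDiffOn ℝ ∞ f U ∧ EqOn toFun f (U ∩ S.surface)

variable {S}

lemma SmoothFn.continuousOn (b : SmoothFn S) : ContinuousOn b.toFun S.surface := by
  intro x hx
  obtain ⟨U, hU, hxU, f, hf, he⟩ := b.smooth x hx
  have h1 : ContinuousWithinAt f (U ∩ S.surface) x :=
    (hf.continuousOn x hxU).mono inter_subset_left
  have h2 := h1.congr (fun y hy => he hy) (he ⟨hxU, hx⟩)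
  exact (continuousWithinAt_inter' (mem_nhdsWithin_of_mem_nhds (hU.mem_nhds hxU))).1
    (by rwa [inter_comm] at h2)

lemma SmoothFn.memLp (b : SmoothFn S) : MemLp (fun x => (b.toFun x : ℂ)) ∞ S.σ := by
  have hc : ContinuousOn (fun x => (b.toFun x : ℂ)) S.surface :=
    Complex.continuous_ofReal.comp_continuousOn b.continuousOn
  obtain ⟨C, hC⟩ := S.isCompact_surface.exists_bound_of_continuousOn hc
  refine memLp_top_of_bound (hc.aestronglyMeasurable S.isCompact_surface.measurableSet) C ?_
  exact (ae_restrict_iff' S.isCompact_surface.measurableSet).2 (ae_of_all _ hC)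

/-- Multiplication by a smooth function, as an operator in `L₂(Σ)`. -/
def SmoothFn.mul (b : SmoothFn S) : Module.End ℂ S.L2Surf where
  toFun g := (b.memLp.toLp (fun x => (b.toFun x : ℂ)) • g : S.L2Surf)
  map_add' f g := Lp.add_smul _ f g
  map_smul' z g := (Lp.smul_comm z _ g).symm

/-- The boundary conditions with matrices `B₀`, `B_γ`, `B_ν`, `B_{δ,α}`, `B_{δ',β}`. -/
inductive BC
  | free
  | dirichlet
  | neumann
  | delta
  | deltaPrime

/-- The `2 × 4` matrix `B_*` for the strengths `α` and `β`; its entries are multiplication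
operators in `L₂(Σ)`. -/
def bcMatrix (α β : SmoothFn S) : BC → Matrix (Fin 2) (Fin 4) (Module.End ℂ S.L2Surf)
  | .free => !![1, -1, 0, 0; 0, 0, 1, 1]
  | .dirichlet => !![1, 0, 0, 0; 0, 1, 0, 0]
  | .neumann => !![0, 0, 1, 0; 0, 0, 0, 1]
  | .delta => !![1, -1, 0, 0; -α.mul, 0, 1, 1]
  | .deltaPrime => !![1, -1, -β.mul, 0; 0, 0, 1, 1]

/-- The action of a matrix of operators on columns. -/
def applyMatrix (B : Matrix (Fin 2) (Fin 4) (Module.End ℂ S.L2Surf)) :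
    (Fin 4 → S.L2Surf) →ₗ[ℂ] (Fin 2 → S.L2Surf) :=
  LinearMap.pi fun i => ∑ k, (B i k).comp (LinearMap.proj k)

/-! ### Realizations, solution operators and boundary operators -/

/-- Composition of partially defined operators on its natural domain
`{x ∈ dom f | f x ∈ dom g}`. -/
def pcomp {X Y Z : Type*} [AddCommGroup X] [Module ℂ X] [AddCommGroup Y] [Module ℂ Y]
    [AddCommGroup Z] [Module ℂ Z] (g : Y →ₗ.[ℂ] Z) (f : X →ₗ.[ℂ] Y) : X →ₗ.[ℂ] Z :=
  g.comp (f.domRestrict ((g.domain.comap f.toFun).map f.domain.subtype)) (by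
    rintro ⟨x, ⟨y, hy, rfl⟩, hx⟩
    exact hy)

variable (S)

/-- `B_* ϱ`. -/
def traceOp (B : Matrix (Fin 2) (Fin 4) (Module.End ℂ S.L2Surf)) :
    L2 n →ₗ.[ℂ] (Fin 2 → S.L2Surf) :=
  (applyMatrix B).compPMap (rho S c)

/-- The kernel of a partially defined operator, as a subspace of the ambient space. -/
def pker {X Y : Type*} [AddCommGroup X] [Module ℂ X] [AddCommGroup Y] [Module ℂ Y]
    (f : X →ₗ.[ℂ] Y) : Submodule ℂ X := (LinearMap.ker f.toFun).map f.domain.subtype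

/-- The realization `A_*`: `𝒜₊ ⊕ 𝒜₋` on `{u ∈ H²(Ω₊) ⊕ H²(Ω₋) | B_* ϱ u = 0}`. -/
def realization (B : Matrix (Fin 2) (Fin 4) (Module.End ℂ S.L2Surf)) : L2 n →ₗ.[ℂ] L2 n :=
  (opA S c).domRestrict (pker (traceOp S c B))

/-- The solution operator `φ ↦ u` of the problem `𝒜₊ u₊ ⊕ 𝒜₋ u₋ = 0`, `B ϱ u = φ`,
with `u ∈ H²(Ω₊) ⊕ H²(Ω₋)`, defined for all data `φ` for which the problem is solvable
(this is `K_γ` for `B = B_γ` and `K_ν` for `B = B_ν`). -/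
def solutionOp (B : Matrix (Fin 2) (Fin 4) (Module.End ℂ S.L2Surf)) :
    (Fin 2 → S.L2Surf) →ₗ.[ℂ] L2 n :=
  ((traceOp S c B).domRestrict (pker (opA S c))).inverse

/-- The space of boundary data for `B`: the range of `B ϱ` on `H²(Ω₊) ⊕ H²(Ω₋)`. By the trace
theorem it is `H^{3/2}(Σ) × H^{3/2}(Σ)` for `B_γ`, `H^{1/2}(Σ) × H^{1/2}(Σ)` for `B_ν`, and
`H^{3/2}(Σ) × H^{1/2}(Σ)` for `B₀`, `B_{δ,α}`, `B_{δ',β}`. -/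
def dataSpace (B : Matrix (Fin 2) (Fin 4) (Module.End ℂ S.L2Surf)) :
    Submodule ℂ (Fin 2 → S.L2Surf) := LinearMap.range (traceOp S c B).toFun

/-- `0` belongs to the resolvent set: `A` is bijective onto `L₂(ℝⁿ)` with bounded inverse. -/
def ZeroMemResolventSet (A : L2 n →ₗ.[ℂ] L2 n) : Prop :=
  ∃ R : L2 n →L[ℂ] L2 n,
    (∀ f, ∃ h : R f ∈ A.domain, A ⟨R f, h⟩ = f) ∧ ∀ u : A.domain, R (A u) = u

/-- `f` is a bijection from its domain `V` onto `W`. -/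
def IsBijectionBetween {X Y : Type*} [AddCommGroup X] [Module ℂ X] [AddCommGroup Y] [Module ℂ Y]
    (f : X →ₗ.[ℂ] Y) (V : Submodule ℂ X) (W : Submodule ℂ Y) : Prop :=
  f.domain = V ∧ LinearMap.ker f.toFun = ⊥ ∧ LinearMap.range f.toFun = W

variable {S} (α β : SmoothFn S) (b : BC)

/-- The realization `A_*`; `A_γ` and `A_ν` are those for `BC.dirichlet` and `BC.neumann`. -/
def opAstar : L2 n →ₗ.[ℂ] L2 n := realization S c (bcMatrix α β b)

/-- `B_* ϱ`. -/
def opBrho : L2 n →ₗ.[ℂ] (Fin 2 → S.L2Surf) := traceOp S c (bcMatrix α β b)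

/-- The range of `B_* ϱ`. -/
def dataR : Submodule ℂ (Fin 2 → S.L2Surf) := dataSpace S c (bcMatrix α β b)

/-- The Dirichlet solution operator `K_γ`. -/
def opKγ : (Fin 2 → S.L2Surf) →ₗ.[ℂ] L2 n := solutionOp S c (bcMatrix α β .dirichlet)

/-- The Neumann solution operator `K_ν`. -/
def opKν : (Fin 2 → S.L2Surf) →ₗ.[ℂ] L2 n := solutionOp S c (bcMatrix α β .neumann)

/-- `Φ_* = B_* ϱ K_γ`. -/
def opΦ : (Fin 2 → S.L2Surf) →ₗ.[ℂ] (Fin 2 → S.L2Surf) := pcomp (opBrho c α β b) (opKγ c α β)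

/-- `Ψ_* = B_* ϱ K_ν`. -/
def opΨ : (Fin 2 → S.L2Surf) →ₗ.[ℂ] (Fin 2 → S.L2Surf) := pcomp (opBrho c α β b) (opKν c α β)

end Krein

end

open Krein

open MeasureTheory Set Filter
open scoped ContDiff ENNReal Topology

noncomputable section

namespace Krein

/-! ### Graphs of partially defined operators -/

section PartialMaps

variable {X Y Z : Type*} [AddCommGroup X] [Module ℂ X] [AddCommGroup Y] [Module ℂ Y]
  [AddCommGroup Z] [Module ℂ Z]

/-! The formula is linear algebra once the boundary conditions are seen as restrictions of a single
operator. Let `A` be `𝒜₊ ⊕ 𝒜₋` on the H² functions, let `T` be `B_γ ϱ` or `B_ν ϱ`, and `T' = B_* ϱ`.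
The two realizations are `A` restricted to `ker T` and to `ker T'`. If `A|ker T` is bijective, any
`u` can be corrected by the solution `w` of `A w = A u`, `T w = 0`: then `u - w` lies in `ker A` and
has the data `T u`. Hence `T` maps `ker A` bijectively onto its full range, which gives the solution
operator `K`. The same holds for `T'`, so `T' K` is a bijection between the ranges of `T` and `T'`
(`IsInvertible.boundaryOp_bijection`).

For given `f`, let `u` and `v` solve the problems with right-hand side `f` and boundary conditions
`T' u = 0`, `T v = 0`. The difference `v - u` lies in `ker A` and `T' (v - u) = T' v`, so `v - u = K
(T' K)⁻¹ T' v`, which is the formula (`IsInvertible.krein_formula`).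

Analysis enters only through `dom T ⊆ dom A`: the expression `𝒜 u` must be in L₂ for every H²
function (`MemH2.exists_ellipticEq`, `mem_opA_domain`). The matrices `B` do not affect the domain of
`B ϱ`, which is why one argument covers all five boundary conditions. -/

lemma mk_mem_graph_iff {f : X →ₗ.[ℂ] Y} {x : X} {y : Y} :
    (x, y) ∈ f.graph ↔ ∃ h : x ∈ f.domain, f ⟨x, h⟩ = y := by
  rw [LinearPMap.mem_graph_iff]
  constructor
  · rintro ⟨⟨z, hz⟩, rfl, h⟩
    exact ⟨hz, h⟩
  · rintro ⟨h, e⟩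
    exact ⟨⟨x, h⟩, rfl, e⟩

/-- On natural domains, composition of operators is composition of relations. Working with graphs
keeps domain conditions out of the later arguments. -/
lemma mk_mem_graph_pcomp {g : Y →ₗ.[ℂ] Z} {f : X →ₗ.[ℂ] Y} {x : X} {z : Z} :
    (x, z) ∈ (pcomp g f).graph ↔ ∃ y, (x, y) ∈ f.graph ∧ (y, z) ∈ g.graph := by
  simp only [mk_mem_graph_iff]
  constructor
  · rintro ⟨⟨⟨y, hy, rfl⟩, hx⟩, e⟩
    exact ⟨f y, ⟨hx, rfl⟩, hy, e⟩
  · rintro ⟨_, ⟨hx, rfl⟩, hy, e⟩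
    exact ⟨⟨⟨⟨x, hx⟩, hy, rfl⟩, hx⟩, e⟩

lemma mem_pker_iff {f : X →ₗ.[ℂ] Y} {x : X} : x ∈ pker f ↔ (x, 0) ∈ f.graph := by
  rw [mk_mem_graph_iff]
  constructor
  · rintro ⟨y, hy, rfl⟩
    exact ⟨y.2, hy⟩
  · rintro ⟨h, e⟩
    exact ⟨⟨x, h⟩, e, rfl⟩

lemma mk_mem_graph_domRestrict {f : X →ₗ.[ℂ] Y} {V : Submodule ℂ X} {x : X} {y : Y} :
    (x, y) ∈ (f.domRestrict V).graph ↔ x ∈ V ∧ (x, y) ∈ f.graph := by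
  simp only [mk_mem_graph_iff]
  constructor
  · rintro ⟨⟨h, h'⟩, e⟩
    exact ⟨h, h', e⟩
  · rintro ⟨h, h', e⟩
    exact ⟨⟨h, h'⟩, e⟩

/-- Injectivity is essential: `LinearPMap.inverse` is built from the flipped graph, and if that
graph is not single-valued the construction returns the zero map on the range. -/
lemma mk_mem_graph_inverse {f : X →ₗ.[ℂ] Y} (hf : LinearMap.ker f.toFun = ⊥) {x : X} {y : Y} :
    (y, x) ∈ f.inverse.graph ↔ (x, y) ∈ f.graph := by
  rw [LinearPMap.inverse_graph hf]
  constructor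
  · rintro ⟨⟨x', y'⟩, h, e⟩
    obtain ⟨rfl, rfl⟩ := Prod.mk.inj e
    exact h
  · intro h
    exact ⟨(x, y), h, rfl⟩

lemma mk_mem_graph_sub {f g : X →ₗ.[ℂ] Y} {x : X} {y z : Y} (hf : (x, y) ∈ f.graph)
    (hg : (x, z) ∈ g.graph) : (x, y - z) ∈ (f - g).graph := by
  simp only [mk_mem_graph_iff] at *
  obtain ⟨h, rfl⟩ := hf
  obtain ⟨h', rfl⟩ := hg
  exact ⟨⟨h, h'⟩, rfl⟩

lemma mk_mem_graph_neg {f : X →ₗ.[ℂ] Y} {x : X} {y : Y} (hf : (x, y) ∈ f.graph) :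
    (x, -y) ∈ (-f).graph := by
  simp only [mk_mem_graph_iff] at *
  obtain ⟨h, rfl⟩ := hf
  exact ⟨h, rfl⟩

lemma mem_range_toFun_iff {f : X →ₗ.[ℂ] Y} {y : Y} :
    y ∈ LinearMap.range f.toFun ↔ ∃ x, (x, y) ∈ f.graph := by
  simp only [mk_mem_graph_iff]
  constructor
  · rintro ⟨x, h⟩
    exact ⟨x, x.2, h⟩
  · rintro ⟨x, hx, h⟩
    exact ⟨⟨x, hx⟩, h⟩

lemma ker_toFun_eq_bot_iff {f : X →ₗ.[ℂ] Y} :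
    LinearMap.ker f.toFun = ⊥ ↔ ∀ x, (x, 0) ∈ f.graph → x = 0 := by
  simp only [LinearMap.ker_eq_bot', mk_mem_graph_iff]
  constructor
  · rintro h x ⟨hx, e⟩
    exact congrArg Subtype.val (h ⟨x, hx⟩ e)
  · exact fun h x e => Subtype.ext (h x ⟨x.2, e⟩)

/-- Equality of partial operators includes equality of domains. A common point of the two graphs
over every `x` makes both operators everywhere defined, and single-valuedness then forces agreement.
-/
lemma eq_of_graph_sections {f g : X →ₗ.[ℂ] Y}
    (h : ∀ x, ∃ y, (x, y) ∈ f.graph ∧ (x, y) ∈ g.graph) : f = g := by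
  refine LinearPMap.eq_of_eq_graph (Submodule.ext ?_)
  rintro ⟨x, y⟩
  obtain ⟨z, hf, hg⟩ := h x
  constructor
  · intro hy
    rwa [f.mem_graph_snd_inj hy hf rfl]
  · intro hy
    rwa [g.mem_graph_snd_inj hy hg rfl]

/-! ### The abstract Krein formula -/

/-- The partially defined operator `A` is a bijection of its domain onto the whole space. -/
def IsInvertible (A : X →ₗ.[ℂ] X) : Prop :=
  LinearMap.ker A.toFun = ⊥ ∧ LinearMap.range A.toFun = ⊤

lemma IsInvertible.inverse_domain {A : X →ₗ.[ℂ] X} (h : IsInvertible A) :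
    A.inverse.domain = ⊤ := by
  rw [LinearPMap.inverse_domain, h.2]

variable {A : X →ₗ.[ℂ] X} {T T' : X →ₗ.[ℂ] Y}

/-- Solvability of `A u = f`, `T u = 0`. -/
lemma IsInvertible.exists_solution (h : IsInvertible (A.domRestrict (pker T))) (f : X) :
    ∃ u, (u, f) ∈ A.graph ∧ (u, 0) ∈ T.graph := by
  obtain ⟨u, hu⟩ := mem_range_toFun_iff.1 (h.2 ▸ Submodule.mem_top : f ∈ _)
  rw [mk_mem_graph_domRestrict, mem_pker_iff] at hu
  exact ⟨u, hu.2, hu.1⟩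

/-- Uniqueness for `A u = 0`, `T u = 0`. -/
lemma IsInvertible.eq_zero (h : IsInvertible (A.domRestrict (pker T))) {u : X}
    (hA : (u, 0) ∈ A.graph) (hT : (u, 0) ∈ T.graph) : u = 0 :=
  ker_toFun_eq_bot_iff.1 h.1 u (mk_mem_graph_domRestrict.2 ⟨mem_pker_iff.2 hT, hA⟩)

lemma IsInvertible.mem_inverse_graph (h : IsInvertible (A.domRestrict (pker T))) {u f : X}
    (hA : (u, f) ∈ A.graph) (hT : (u, 0) ∈ T.graph) :
    (f, u) ∈ (A.domRestrict (pker T)).inverse.graph :=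
  (mk_mem_graph_inverse h.1).2 (mk_mem_graph_domRestrict.2 ⟨mem_pker_iff.2 hT, hA⟩)

/-- The data `T u` is attained by a solution of `A v = 0`. -/
lemma IsInvertible.exists_homogeneous (h : IsInvertible (A.domRestrict (pker T)))
    (hD : T.domain ≤ A.domain) {u : X} {φ : Y} (hu : (u, φ) ∈ T.graph) :
    ∃ v, (v, 0) ∈ A.graph ∧ (v, φ) ∈ T.graph := by
  obtain ⟨f, hf⟩ := LinearPMap.mem_domain_iff.1 (hD (LinearPMap.mem_domain_of_mem_graph hu))
  -- Here `w` has the same image under `A` as `u` but zero data, so subtracting it kills `A u` and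
  -- keeps `T u`.
  obtain ⟨w, hw, hw'⟩ := h.exists_solution f
  exact ⟨u - w, by simpa using A.graph.sub_mem hf hw, by simpa using T.graph.sub_mem hu hw'⟩

/-- Uniqueness for the realization and for the homogeneous problem with data is the same condition,
`ker A ∩ ker T = 0`. It makes `T` injective on `ker A`, so that the inverse defining the solution
operator is meaningful. -/
lemma IsInvertible.mem_solution_graph (h : IsInvertible (A.domRestrict (pker T))) {φ : Y} {u : X} :
    (φ, u) ∈ (T.domRestrict (pker A)).inverse.graph ↔ (u, 0) ∈ A.graph ∧ (u, φ) ∈ T.graph := by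
  have hk : LinearMap.ker (T.domRestrict (pker A)).toFun = ⊥ := by
    rw [ker_toFun_eq_bot_iff]
    intro x hx
    rw [mk_mem_graph_domRestrict, mem_pker_iff] at hx
    exact h.eq_zero hx.1 hx.2
  rw [mk_mem_graph_inverse hk, mk_mem_graph_domRestrict, mem_pker_iff]

lemma IsInvertible.solution_domain (h : IsInvertible (A.domRestrict (pker T)))
    (hD : T.domain ≤ A.domain) :
    (T.domRestrict (pker A)).inverse.domain = LinearMap.range T.toFun := by
  ext φ
  simp only [LinearPMap.mem_domain_iff, mem_range_toFun_iff, h.mem_solution_graph]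
  exact ⟨fun ⟨u, hu⟩ => ⟨u, hu.2⟩, fun ⟨u, hu⟩ => h.exists_homogeneous hD hu⟩

lemma IsInvertible.mem_boundaryOp_graph (h : IsInvertible (A.domRestrict (pker T))) {φ ψ : Y} :
    (φ, ψ) ∈ (pcomp T' (T.domRestrict (pker A)).inverse).graph ↔
      ∃ u, (u, 0) ∈ A.graph ∧ (u, φ) ∈ T.graph ∧ (u, ψ) ∈ T'.graph := by
  simp only [mk_mem_graph_pcomp, h.mem_solution_graph, and_assoc]

/-- The boundary operator `T' K`, where `K` solves `A u = 0`, `T u = φ`, is a bijection between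
the ranges of `T` and `T'`. -/
lemma IsInvertible.boundaryOp_bijection (h : IsInvertible (A.domRestrict (pker T)))
    (h' : IsInvertible (A.domRestrict (pker T'))) (hD : T.domain ≤ A.domain)
    (hT : T'.domain = T.domain) :
    IsBijectionBetween (pcomp T' (T.domRestrict (pker A)).inverse)
      (LinearMap.range T.toFun) (LinearMap.range T'.toFun) := by
  refine ⟨?_, ?_, ?_⟩
  · ext φ
    simp only [LinearPMap.mem_domain_iff, mem_range_toFun_iff, h.mem_boundaryOp_graph]
    constructor
    · rintro ⟨_, u, _, hu, _⟩
      exact ⟨u, hu⟩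
    · rintro ⟨u, hu⟩
      obtain ⟨v, hv, hv'⟩ := h.exists_homogeneous hD hu
      obtain ⟨ψ, hψ⟩ :=
        LinearPMap.mem_domain_iff.1 (hT ▸ LinearPMap.mem_domain_of_mem_graph hv')
      exact ⟨ψ, v, hv, hv', hψ⟩
  · rw [ker_toFun_eq_bot_iff]
    intro φ hφ
    -- A solution with vanishing `T'` data lies in the kernel of the other realization, hence is
    -- zero, and so is its `T` data.
    obtain ⟨u, hu, hφ, h0⟩ := h.mem_boundaryOp_graph.1 hφ
    exact T.graph_fst_eq_zero_snd hφ (h'.eq_zero hu h0)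
  · ext ψ
    simp only [mem_range_toFun_iff, h.mem_boundaryOp_graph]
    constructor
    · rintro ⟨_, u, _, _, hu⟩
      exact ⟨u, hu⟩
    · rintro ⟨u, hu⟩
      -- Surjectivity is the correction argument with `T'` in the role of `T`; the preimage of `ψ`
      -- is the `T` data of the corrected function.
      obtain ⟨v, hv, hv'⟩ := h'.exists_homogeneous (hT ▸ hD) hu
      obtain ⟨φ, hφ⟩ :=
        LinearPMap.mem_domain_iff.1 (hT.symm ▸ LinearPMap.mem_domain_of_mem_graph hv')
      exact ⟨φ, v, hv, hφ, hv'⟩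

/-- Krein's resolvent formula for two restrictions `A|ker T'` and `A|ker T` of an operator. -/
theorem IsInvertible.krein_formula (h : IsInvertible (A.domRestrict (pker T)))
    (h' : IsInvertible (A.domRestrict (pker T'))) (hD : T.domain ≤ A.domain)
    (hT : T'.domain = T.domain) :
    (A.domRestrict (pker T')).inverse - (A.domRestrict (pker T)).inverse =
      -(pcomp (T.domRestrict (pker A)).inverse
        (pcomp (pcomp T' (T.domRestrict (pker A)).inverse).inverse
          (pcomp T' (A.domRestrict (pker T)).inverse))) := by
  refine eq_of_graph_sections fun f => ?_
  obtain ⟨u, hu, hu'⟩ := h'.exists_solution f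
  obtain ⟨v, hv, hv'⟩ := h.exists_solution f
  obtain ⟨φ, hφ⟩ :=
    LinearPMap.mem_domain_iff.1 (hT ▸ LinearPMap.mem_domain_of_mem_graph hu' : u ∈ T.domain)
  obtain ⟨ψ, hψ⟩ :=
    LinearPMap.mem_domain_iff.1 (hT ▸ LinearPMap.mem_domain_of_mem_graph hv' : v ∈ T'.domain)
  -- The right-hand sides cancel, so `v - u` is the homogeneous solution with `T` data `-φ` and `T'`
  -- data `ψ`; thus `T' K` sends `-φ` to `ψ`.
  have hA : (v - u, 0) ∈ A.graph := by simpa using A.graph.sub_mem hv hu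
  have hTφ : (v - u, -φ) ∈ T.graph := by simpa using T.graph.sub_mem hv' hφ
  have hTψ : (v - u, ψ) ∈ T'.graph := by simpa using T'.graph.sub_mem hψ hu'
  refine ⟨u - v, mk_mem_graph_sub (h'.mem_inverse_graph hu hu') (h.mem_inverse_graph hv hv'), ?_⟩
  rw [← neg_sub v u]
  refine mk_mem_graph_neg (mk_mem_graph_pcomp.2 ⟨-φ, mk_mem_graph_pcomp.2 ⟨ψ,
    mk_mem_graph_pcomp.2 ⟨v, h.mem_inverse_graph hv hv', hψ⟩, ?_⟩,
    h.mem_solution_graph.2 ⟨hA, hTφ⟩⟩)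
  exact (mk_mem_graph_inverse (h.boundaryOp_bijection h' hD hT).2.1).2
    (h.mem_boundaryOp_graph.2 ⟨v - u, hA, hTφ, hTψ⟩)

end PartialMaps

/-! ### The product rule and the maximal domain -/

variable {n : ℕ}

lemma partialDeriv_mul {a φ : E n → ℝ} (ha : ContDiff ℝ ∞ a) (hφ : ContDiff ℝ ∞ φ) (j : Fin n)
    (x : E n) :
    partialDeriv j (fun y => a y * φ y) x = a x * partialDeriv j φ x + φ x * partialDeriv j a x := by
  simp [partialDeriv, fderiv_fun_mul (ha.differentiable (by simp) x)
    (hφ.differentiable (by simp) x)]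

lemma memLp_smul_of_bound {Ω : Set (E n)} {a : E n → ℝ} {w : E n → ℂ} (ha : Continuous a) {C : ℝ}
    (hC : ∀ x, |a x| ≤ C) (hw : MemLp w 2 (volume.restrict Ω)) :
    MemLp (fun x => a x • w x) 2 (volume.restrict Ω) :=
  hw.smul (memLp_top_of_bound ha.aestronglyMeasurable C (ae_of_all _ hC))

/-- Product rule for weak derivatives with a smooth bounded factor. -/
lemma L2Partial.smul_of_bound {Ω : Set (E n)} {j : Fin n} {a : E n → ℝ} {w v : E n → ℂ}
    (ha : ContDiff ℝ ∞ a) {C C' : ℝ} (hC : ∀ x, |a x| ≤ C) (hC' : ∀ x, |partialDeriv j a x| ≤ C')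
    (hw : MemLp w 2 (volume.restrict Ω)) (h : L2Partial Ω j w v) :
    L2Partial Ω j (fun x => a x • w x) (fun x => partialDeriv j a x • w x + a x • v x) := by
  have hd : Continuous (partialDeriv j a) :=
    (ha.continuous_fderiv (by simp)).clm_apply continuous_const
  have haw := memLp_smul_of_bound ha.continuous hC hw
  have hav := memLp_smul_of_bound ha.continuous hC h.1
  have hdw := memLp_smul_of_bound hd hC' hw
  refine ⟨hdw.add hav, fun φ hφ hs => ?_⟩
  -- The product `a φ` is again an admissible test function, with support inside that of `φ`.
  -- Testing the weak derivative of `w` against it moves the factor `a` onto `w`, at the cost of the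
  -- term with `∂ⱼ a`.
  have ht : IsTest fun y => a y * φ y := ⟨ha.mul hφ.1, hφ.2.mul_left⟩
  have e := h.2 _ ht ((closure_mono (Function.support_mul_subset_right a φ)).trans hs)
  have i1 := integrable_smul (hφ.partialDeriv_memLp j (volume.restrict Ω)) haw
  have i2 := integrable_smul (hφ.memLp (volume.restrict Ω)) hdw
  have i3 := integrable_smul (hφ.memLp (volume.restrict Ω)) hav
  have e1 : ∫ x in Ω, partialDeriv j (fun y => a y * φ y) x • w x =
      (∫ x in Ω, partialDeriv j φ x • a x • w x) + ∫ x in Ω, φ x • partialDeriv j a x • w x := by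
    rw [← integral_add i1 i2]
    refine integral_congr_ae (ae_of_all _ fun x => ?_)
    simp only [partialDeriv_mul ha hφ.1, add_smul, smul_smul, mul_comm (a x)]
  have e2 : ∫ x in Ω, (a x * φ x) • v x = ∫ x in Ω, φ x • a x • v x := by
    refine integral_congr_ae (ae_of_all _ fun x => ?_)
    simp only [smul_smul, mul_comm (a x)]
  simp only [smul_add]
  rw [e1, e2] at e
  rw [integral_add i2 i3]
  linear_combination e

lemma L2Partial.sum {ι : Type*} (s : Finset ι) {Ω : Set (E n)} {j : Fin n} {u v : ι → E n → ℂ}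
    (hu : ∀ i, MemLp (u i) 2 (volume.restrict Ω)) (h : ∀ i, L2Partial Ω j (u i) (v i)) :
    L2Partial Ω j (∑ i ∈ s, u i) (∑ i ∈ s, v i) := by
  classical
  induction s using Finset.induction_on with
  | empty => simpa using L2Partial.zero
  | insert i s hi ih =>
    rw [Finset.sum_insert hi, Finset.sum_insert hi]
    exact (h i).add (hu i) (memLp_finsetSum' s fun i _ => hu i) ih

lemma Coeffs.abs_le (c : Coeffs n) (j k : Fin n) : ∃ C : ℝ, ∀ x, |c.a j k x| ≤ C := by
  obtain ⟨C, hC⟩ := c.bounded j k 0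
  exact ⟨C, fun x => by simpa using hC x⟩

lemma Coeffs.abs_partialDeriv_le (c : Coeffs n) (i j k : Fin n) :
    ∃ C : ℝ, ∀ x, |partialDeriv i (c.a j k) x| ≤ C := by
  obtain ⟨C, hC⟩ := c.bounded j k 1
  refine ⟨C, fun x => ?_⟩
  have h := (fderiv ℝ (c.a j k) x).le_opNorm (EuclideanSpace.single i 1)
  have h1 := hC x
  rw [norm_iteratedFDeriv_one] at h1
  simp only [PiLp.norm_single, norm_one, mul_one] at h
  exact h.trans h1

/-- The expression `𝒜 u` is in `L₂(Ω)` for every `u ∈ H²(Ω)`. -/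
lemma MemH2.exists_ellipticEq (c : Coeffs n) {Ω : Set (E n)} {u : E n → ℂ} (h : MemH2 Ω u) :
    ∃ f, MemLp f 2 (volume.restrict Ω) ∧ EllipticEq c Ω u f := by
  obtain ⟨hu, w, d, hw, hd⟩ := h
  -- The weak derivative of the flux comes from the Leibniz rule. It is in L₂ because the
  -- coefficients and their first derivatives are bounded.
  have hq : ∀ j, L2Partial Ω j (fun x => ∑ k, c.a j k x • w k x)
      (∑ k, fun x => partialDeriv j (c.a j k) x • w k x + c.a j k x • d j k x) := by
    intro j
    have hs : (fun x => ∑ k, c.a j k x • w k x) = ∑ k, fun x => c.a j k x • w k x := by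
      funext x
      simp
    rw [hs]
    refine L2Partial.sum _ (fun k => ?_) fun k => ?_
    · obtain ⟨C, hC⟩ := c.abs_le j k
      exact memLp_smul_of_bound (c.smooth j k).continuous hC (hw k).1
    · obtain ⟨C, hC⟩ := c.abs_le j k
      obtain ⟨C', hC'⟩ := c.abs_partialDeriv_le j j k
      exact (hd j k).smul_of_bound (c.smooth j k) hC hC' (hw k).1
  obtain ⟨C, hC⟩ := c.bounded_a0
  exact ⟨_, ((memLp_finsetSum _ fun j _ => (hq j).1).neg).add
    (memLp_smul_of_bound c.smooth_a0.continuous hC hu), w, _, hw, hq, ae_of_all _ fun x => rfl⟩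

/-- Each function is extended by zero and the extensions are added; by disjointness neither affects
the other's set. This glues the two halves of `𝒜 u` into one element of `L2 n`. -/
lemma exists_Lp_of_memLp_restrict {U V : Set (E n)} (hU : MeasurableSet U) (hV : MeasurableSet V)
    (hUV : Disjoint U V) {f g : E n → ℂ} (hf : MemLp f 2 (volume.restrict U))
    (hg : MemLp g 2 (volume.restrict V)) :
    ∃ F : L2 n, f =ᵐ[volume.restrict U] F ∧ g =ᵐ[volume.restrict V] F := by
  have h : MemLp (U.indicator f + V.indicator g) 2 volume :=
    ((memLp_indicator_iff_restrict hU).2 hf).add ((memLp_indicator_iff_restrict hV).2 hg)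
  refine ⟨h.toLp _, ?_, ?_⟩
  · filter_upwards [ae_restrict_of_ae h.coeFn_toLp, ae_restrict_mem hU] with x hx hxU
    rw [hx, Pi.add_apply, indicator_of_mem hxU, indicator_of_notMem (hUV.notMem_of_mem_left hxU),
      add_zero]
  · filter_upwards [ae_restrict_of_ae h.coeFn_toLp, ae_restrict_mem hV] with x hx hxV
    rw [hx, Pi.add_apply, indicator_of_mem hxV, indicator_of_notMem (hUV.notMem_of_mem_right hxV),
      zero_add]

/-! ### Verification of the abstract hypotheses for `𝒜₊ ⊕ 𝒜₋` and `B ϱ` -/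

variable (S : Interface n) (c : Coeffs n)

/-- The domain of `𝒜₊ ⊕ 𝒜₋` is all of `H²(Ω₊) ⊕ H²(Ω₋)`. -/
lemma mem_opA_domain {u : L2 n} (hu : S.MemH2Sum u) : u ∈ (opA S c).domain := by
  obtain ⟨f, hf, ef⟩ := hu.1.exists_ellipticEq c
  obtain ⟨g, hg, eg⟩ := hu.2.exists_ellipticEq c
  obtain ⟨F, h1, h2⟩ := exists_Lp_of_memLp_restrict S.isOpen_outer.measurableSet
    S.isOpen_inner.measurableSet S.disjoint_outer_inner hf hg
  -- The domain of `Submodule.toLinearPMap` is by construction the first projection of the given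
  -- subspace, so exhibiting one pair suffices; no uniqueness of the image is involved.
  exact ⟨(u, F), ⟨hu, ef.congr EventuallyEq.rfl h1, eg.congr EventuallyEq.rfl h2⟩, rfl⟩

/-- Membership in `graphRho` already contains the H² condition, and applying `B` leaves the domain
of `rho` unchanged. -/
lemma traceOp_domain_le (B : Matrix (Fin 2) (Fin 4) (Module.End ℂ S.L2Surf)) :
    (traceOp S c B).domain ≤ (opA S c).domain := by
  rintro _ ⟨p, hp, rfl⟩
  exact mem_opA_domain S c hp.1

/-- The passage from the resolvent condition to pure algebra: a two-sided inverse gives injectivity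
and surjectivity. -/
lemma ZeroMemResolventSet.isInvertible {A : L2 n →ₗ.[ℂ] L2 n} (h : ZeroMemResolventSet A) :
    IsInvertible A := by
  obtain ⟨R, hR, hR'⟩ := h
  refine ⟨LinearMap.ker_eq_bot'.2 fun u hu => Subtype.ext ?_,
    LinearMap.range_eq_top.2 fun f => ?_⟩
  · have hu' : A u = 0 := hu
    rw [← hR' u, hu', _root_.map_zero]
    rfl
  · obtain ⟨hf, e⟩ := hR f
    exact ⟨_, e⟩

end Krein

end


theorem mainTheorem4 {n : ℕ} (S : Interface n) (c : Coeffs n) (α β : SmoothFn S)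
    (hβ : ∀ x ∈ S.surface, β.toFun x ≠ 0) (b : BC)
    (h : ZeroMemResolventSet (opAstar c α β b))
    (hγ : ZeroMemResolventSet (opAstar c α β .dirichlet))
    (hν : ZeroMemResolventSet (opAstar c α β .neumann)) :
    -- the inverses are everywhere defined
    ((opAstar c α β b).inverse.domain = ⊤ ∧
      (opAstar c α β .dirichlet).inverse.domain = ⊤ ∧
      (opAstar c α β .neumann).inverse.domain = ⊤) ∧
    -- comparison with the Dirichlet realization
    ((opKγ c α β).domain = dataR c α β .dirichlet ∧
      IsBijectionBetween (opΦ c α β b) (dataR c α β .dirichlet) (dataR c α β b) ∧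
      (opAstar c α β b).inverse - (opAstar c α β .dirichlet).inverse =
        -(pcomp (opKγ c α β) (pcomp (opΦ c α β b).inverse
          (pcomp (opBrho c α β b) (opAstar c α β .dirichlet).inverse)))) ∧
    -- comparison with the Neumann realization
    ((opKν c α β).domain = dataR c α β .neumann ∧
      IsBijectionBetween (opΨ c α β b) (dataR c α β .neumann) (dataR c α β b) ∧
      (opAstar c α β b).inverse - (opAstar c α β .neumann).inverse =
        -(pcomp (opKν c α β) (pcomp (opΨ c α β b).inverse
          (pcomp (opBrho c α β b) (opAstar c α β .neumann).inverse)))) := by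
  have i := h.isInvertible
  have iγ := hγ.isInvertible
  have iν := hν.isInvertible
  refine ⟨⟨i.inverse_domain, iγ.inverse_domain, iν.inverse_domain⟩, ⟨?_, ?_, ?_⟩, ?_, ?_, ?_⟩
  · exact iγ.solution_domain (traceOp_domain_le S c _)
  -- The `rfl` is the equality of domains: both trace operators are a matrix composed with the same
  -- `rho`, whose domain they inherit by definition.
  · exact iγ.boundaryOp_bijection i (traceOp_domain_le S c _) rfl
  · exact iγ.krein_formula i (traceOp_domain_le S c _) rfl
  · exact iν.solution_domain (traceOp_domain_le S c _)
  · exact iν.boundaryOp_bijection i (traceOp_domain_le S c _) rfl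
  · exact iν.krein_formula i (traceOp_domain_le S c _) rfl
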